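/- There is a real Banach space $(F, \Vert \cdot \Vert)$ with a Schauder basis $(f_n)_{n \geq 1}$, with associated partial sum operators $P_n : \sum_{k=1}^{\infty} r_k f_k \mapsto \sum_{k=1}^{n} r_k f_k$ and dual basis $(f_n^*)_{n \geq 1} \subset F^*$ (the coordinate functionals, $f_n^*(f_m) = \delta_{nm}$), such that the basis is monotone, i.e. $\Vert P_n \Vert \leq 1$ for every $n \geq 1$, and: (1) $\Vert f \Vert \geq \Vert P_n f \Vert + 4^{-n-1} \Vert f - P_n f \Vert$ for all $f \in F$ and all integers $n \geq 1$; (2) the norm of $F$ is strictly convex on the linear span of $\{ f_1, f_2, \dots \}$; (3) $F$ is isometrically universal for all separable Banach spaces, i.e. every separable real Banach space admits a linear isometric embedding into $F$; (4) the norm-closed linear span $\overline{\mathrm{span}} \{ f_1^*, f_2^*, \dots \} \subset F^*$, with the dual norm, is isometrically universal for all separable Banach spaces, in the same sense. -/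

import Mathlib

universe u v

/-- A real normed space `E` is isometrically universal for all separable Banach spaces if every
separable real Banach space admits a linear isometric embedding into `E`. -/
def IsometricallyUniversal (E : Type v) [NormedAddCommGroup E] [NormedSpace ℝ E] : Prop :=
  ∀ (X : Type u) [NormedAddCommGroup X] [NormedSpace ℝ X] [CompleteSpace X]
    [TopologicalSpace.SeparableSpace X], Nonempty (X →ₗᵢ[ℝ] E)

/-- A Schauder basis is monotone if all its partial sum operators have norm at most one. -/
def IsMonotoneBasis {F : Type v} [NormedAddCommGroup F] [NormedSpace ℝ F]
    (b : SchauderBasis ℝ F) : Prop :=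
  ∀ n : ℕ, ‖SchauderBasis.proj b n‖ ≤ 1

/-- The closed linear span, in the norm of the dual space, of the coordinate functionals
(the dual basis) of a Schauder basis. -/
noncomputable def dualBasisClosedSpan {F : Type v} [NormedAddCommGroup F] [NormedSpace ℝ F]
    (b : SchauderBasis ℝ F) : Submodule ℝ (StrongDual ℝ F) :=
  (Submodule.span ℝ (Set.range b.coord)).topologicalClosure

/-! Let `W` be the space of continuous functions on the Cantor space: it is universal and has a
monotone basis of cylinder indicators (`Cantor.basis`). A space with monotone projections P_k is
renormed by the supremum over k ≥ 1 of ‖P_k x‖ + 2^{-k} τ(x), where the norm τ ≤ ‖·‖ combines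
weighted tails ‖x - P_j x‖ with a Hilbert norm. The tails give the quantitative monotonicity. On the
span the supremum is attained, so equality in the triangle inequality descends to the Hilbert norm,
whence strict convexity (`exists_strict_renorming`).

A renorming usually destroys isometric copies, but this one keeps the norm of x whenever ‖P_k x‖ ≤
(1 - 2^{-k})‖x‖ for all k. Such a copy of `W` exists in E = ℓ²(`W`): x ↦ (w_j x)_j with Σ w_j² = 1,
spread so slowly that the first n blocks carry at most the fraction 1 - 2^{-n} of the norm. The map
f ↦ Σ w_j f_j is a left inverse with the same decay; it supplies almost norming functionals for this
copy whose dual partial sums are small too.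

To get both copies at once, renorm E × V, where V is the closed span of the dual basis of E. The
first factor carries the copy in the space. Dually, x in `W` gives the functional (y, φ) ↦ φ(J x);
enlarging the norm cannot increase its dual norm, and does not decrease it because the almost
norming φ in V keep norm at most one (`exists_isometric_copies`). -/

open Filter Topology

/-! ### Universality of the continuous functions on the Cantor space -/

/-- Banach–Mazur: every separable real Banach space embeds isometrically into the space of
continuous functions on the Cantor space. -/
theorem isometricallyUniversal_cantor :
    IsometricallyUniversal.{u} C(ℕ → Bool, ℝ) := by
  intro X _ _ _ _
  let K : Set (WeakDual ℝ X) := WeakDual.toStrongDual ⁻¹' Metric.closedBall (0 : StrongDual ℝ X) 1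
  have hK : IsCompact K := WeakDual.isCompact_closedBall 0 1
  have : TopologicalSpace.MetrizableSpace K := WeakDual.metrizable_of_isCompact ℝ X K hK
  let : MetricSpace K := TopologicalSpace.metrizableSpaceMetric K
  have : CompactSpace K := isCompact_iff_compactSpace.mp hK
  have : Nonempty K := ⟨⟨0, by simp [K]⟩⟩
  -- The weak-* compact dual ball is metrizable by separability, hence a continuous image of the
  -- Cantor space.
  obtain ⟨g, hg, hgs⟩ := exists_nat_bool_continuous_surjective_of_compact K
  have hcont : ∀ x : X, Continuous fun s => (g s : WeakDual ℝ X) x := fun x =>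
    (WeakDual.eval_continuous x).comp (continuous_subtype_val.comp hg)
  let T : X →ₗ[ℝ] C(ℕ → Bool, ℝ) :=
    { toFun := fun x => ⟨fun s => (g s : WeakDual ℝ X) x, hcont x⟩
      map_add' := fun x y => by ext s; exact map_add (g s : WeakDual ℝ X) x y
      map_smul' := fun c x => by ext s; exact map_smul (g s : WeakDual ℝ X) c x }
  refine ⟨⟨T, fun x => le_antisymm ?_ ?_⟩⟩
  · refine (ContinuousMap.norm_le _ (norm_nonneg x)).2 fun s => ?_
    have h1 : ‖WeakDual.toStrongDual (g s : WeakDual ℝ X)‖ ≤ 1 := by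
      simpa only [K, Set.mem_preimage, mem_closedBall_zero_iff] using (g s).2
    exact ((WeakDual.toStrongDual (g s : WeakDual ℝ X)).le_opNorm x).trans
      (mul_le_of_le_one_left (norm_nonneg x) h1)
  · obtain ⟨φ, hφ1, hφ⟩ := exists_dual_vector'' ℝ x
    obtain ⟨s, hs⟩ := hgs ⟨StrongDual.toWeakDual φ, by simpa [K] using hφ1⟩
    have h2 : (T x) s = ‖x‖ := by
      change (g s : WeakDual ℝ X) x = ‖x‖
      rw [hs]; exact hφ
    calc ‖x‖ = ‖(T x) s‖ := by rw [h2]; simp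
      _ ≤ ‖T x‖ := (T x).norm_coe_le_norm s

/-! ### Schauder bases from biorthogonal systems -/

namespace SchauderBasis

variable {X : Type*} [NormedAddCommGroup X] [NormedSpace ℝ X]

/-- A biorthogonal system whose partial sums converge is a Schauder basis. -/
noncomputable def ofTendsto (e : ℕ → X) (c : ℕ → StrongDual ℝ X)
    (ortho : ∀ i j, c i (e j) = if i = j then 1 else 0)
    (h : ∀ x, Tendsto (fun n => ∑ i ∈ Finset.range n, c i x • e i) atTop (𝓝 x)) :
    SchauderBasis ℝ X where
  basis := e
  coord := c
  ortho i j := by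
    rw [ortho]
    split_ifs with h <;> simp [Pi.single, Function.update, h]
  expansion x := by
    rw [HasSum, SummationFilter.conditional_filter_eq_map_range, tendsto_map'_iff]
    exact h x

/-- On the span the partial sums are eventually exact; contractivity carries convergence to the
closure. -/
theorem tendsto_partialSum_of_dense (e : ℕ → X) (c : ℕ → StrongDual ℝ X)
    (ortho : ∀ i j, c i (e j) = if i = j then 1 else 0)
    (bound : ∀ n x, ‖∑ i ∈ Finset.range n, c i x • e i‖ ≤ ‖x‖)
    (dense : ∀ x, x ∈ closure (Submodule.span ℝ (Set.range e) : Set X)) (x : X) :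
    Tendsto (fun n => ∑ i ∈ Finset.range n, c i x • e i) atTop (𝓝 x) := by
  have hspan : ∀ y ∈ Submodule.span ℝ (Set.range e), ∃ m, ∀ n, m ≤ n →
      ∑ i ∈ Finset.range n, c i y • e i = y := by
    intro y hy
    induction hy using Submodule.span_induction with
    | mem y hy =>
      obtain ⟨j, rfl⟩ := hy
      refine ⟨j + 1, fun n hn => ?_⟩
      rw [Finset.sum_eq_single j]
      · simp [ortho]
      · intro i _ hij; simp [ortho, hij]
      · intro hj; exact absurd (Finset.mem_range.2 (by omega)) hj
    | zero => exact ⟨0, fun n _ => by simp⟩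
    | add y z _ _ hy hz =>
      obtain ⟨m, hm⟩ := hy
      obtain ⟨k, hk⟩ := hz
      refine ⟨max m k, fun n hn => ?_⟩
      simp only [map_add, add_smul, Finset.sum_add_distrib]
      rw [hm n (le_trans (le_max_left _ _) hn), hk n (le_trans (le_max_right _ _) hn)]
    | smul a y _ hy =>
      obtain ⟨m, hm⟩ := hy
      refine ⟨m, fun n hn => ?_⟩
      simp only [map_smul, smul_assoc, ← Finset.smul_sum]
      rw [hm n hn]
  rw [Metric.tendsto_atTop]
  intro ε hε
  obtain ⟨y, hy, hxy⟩ := Metric.mem_closure_iff.1 (dense x) (ε / 2) (by positivity)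
  obtain ⟨m, hm⟩ := hspan y hy
  refine ⟨m, fun n hn => ?_⟩
  have h1 := bound n (x - y)
  simp only [map_sub, sub_smul, Finset.sum_sub_distrib] at h1
  rw [hm n hn, ← dist_eq_norm, ← dist_eq_norm] at h1
  calc dist (∑ i ∈ Finset.range n, c i x • e i) x
      ≤ dist (∑ i ∈ Finset.range n, c i x • e i) y + dist y x := dist_triangle _ _ _
    _ ≤ dist x y + dist x y := by rw [dist_comm y x]; gcongr
    _ < ε := by linarith

/-- A biorthogonal system with dense span and contractive partial sums is a Schauder basis. -/
noncomputable def ofDense (e : ℕ → X) (c : ℕ → StrongDual ℝ X)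
    (ortho : ∀ i j, c i (e j) = if i = j then 1 else 0)
    (bound : ∀ n x, ‖∑ i ∈ Finset.range n, c i x • e i‖ ≤ ‖x‖)
    (dense : ∀ x, x ∈ closure (Submodule.span ℝ (Set.range e) : Set X)) : SchauderBasis ℝ X :=
  ofTendsto e c ortho (tendsto_partialSum_of_dense e c ortho bound dense)

theorem isMonotoneBasis_iff (b : SchauderBasis ℝ X) :
    IsMonotoneBasis b ↔ ∀ n x, ‖b.proj n x‖ ≤ ‖x‖ :=
  forall_congr' fun n =>
    ⟨fun h x => by simpa using (b.proj n).le_of_opNorm_le h x,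
      fun h => ContinuousLinearMap.opNorm_le_bound _ zero_le_one (by simpa using h)⟩

theorem ortho_ite (b : SchauderBasis ℝ X) (i j : ℕ) :
    b.coord i (b.basis j) = if i = j then 1 else 0 := by
  rw [b.ortho]
  split_ifs with h <;> simp [Pi.single, Function.update, h]

theorem mem_of_basis_mem (b : SchauderBasis ℝ X) {Y : Type*} [NormedAddCommGroup Y]
    [NormedSpace ℝ Y] (T : X →L[ℝ] Y) (p : Submodule ℝ Y) (hp : IsClosed (p : Set Y))
    (h : ∀ i, T (b.basis i) ∈ p) (x : X) : T x ∈ p := by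
  refine hp.mem_of_tendsto ((T.continuous.tendsto x).comp (b.tendsto_proj x))
    (Eventually.of_forall fun n => ?_)
  simp only [Function.comp_apply, proj_apply, map_sum, map_smul]
  exact Submodule.sum_mem _ fun i _ => Submodule.smul_mem _ _ (h i)

/-- The image of a Schauder basis under an isomorphism. -/
noncomputable def mapEquiv (b : SchauderBasis ℝ X) {Y : Type*} [NormedAddCommGroup Y] [NormedSpace ℝ Y]
    (T : X ≃L[ℝ] Y) : SchauderBasis ℝ Y :=
  ofTendsto (fun n => T (b.basis n)) (fun n => (b.coord n).comp (T.symm : Y →L[ℝ] X))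
    (fun i j => by simp [ortho_ite]) fun y => by
      have := (T.continuous.tendsto (T.symm y)).comp (b.tendsto_proj (T.symm y))
      simpa [Function.comp_def, proj_apply] using this

theorem mapEquiv_proj (b : SchauderBasis ℝ X) {Y : Type*} [NormedAddCommGroup Y]
    [NormedSpace ℝ Y] (T : X ≃L[ℝ] Y) (n : ℕ) (x : X) :
    (b.mapEquiv T).proj n (T x) = T (b.proj n x) := by
  simp [proj_apply, mapEquiv, ofTendsto]

end SchauderBasis

namespace lp

variable {W : Type*} [NormedAddCommGroup W]

theorem hasSum_norm_sq (f : lp (fun _ : ℕ => W) 2) : HasSum (fun j => ‖f j‖ ^ 2) (‖f‖ ^ 2) := by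
  simpa using lp.hasSum_norm (p := 2) (by norm_num) f

theorem memℓp_two_of_summable {f : ℕ → W} (h : Summable fun j => ‖f j‖ ^ 2) : Memℓp f 2 :=
  memℓp_gen (by simpa using h)

theorem norm_le_of_hasSum_sq {f : lp (fun _ : ℕ => W) 2} {g : ℕ → ℝ} {C : ℝ} (hC : 0 ≤ C)
    (hg : HasSum g (C ^ 2)) (h : ∀ j, ‖f j‖ ^ 2 ≤ g j) : ‖f‖ ≤ C :=
  abs_le_of_sq_le_sq' (hasSum_le h (hasSum_norm_sq f) hg) hC |>.2

theorem norm_le_norm_of_forall {f g : lp (fun _ : ℕ => W) 2} (h : ∀ j, ‖f j‖ ≤ ‖g j‖) :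
    ‖f‖ ≤ ‖g‖ :=
  norm_le_of_hasSum_sq (norm_nonneg g) (hasSum_norm_sq g) fun j => by gcongr; exact h j

end lp

/-! ### The strictly convex, strictly monotone renorming -/

namespace SchauderBasis

variable {X : Type*} [NormedAddCommGroup X] [NormedSpace ℝ X] (b : SchauderBasis ℝ X)

theorem basis_ne_zero (i : ℕ) : b.basis i ≠ 0 := fun h => by
  have := ortho_ite b i i
  simp [h] at this

theorem eq_zero_of_coord {x : X} (h : ∀ i, b.coord i x = 0) : x = 0 := by
  refine tendsto_nhds_unique (b.tendsto_proj x) ?_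
  simp [proj_apply, h]

theorem coord_proj (n i : ℕ) (x : X) :
    b.coord i (b.proj n x) = if i < n then b.coord i x else 0 := by
  simp [proj_apply, ortho_ite]

theorem proj_eq_self_of_le {m n : ℕ} (h : m ≤ n) {x : X} (hx : b.proj m x = x) :
    b.proj n x = x := by
  rw [← hx, proj_comp, min_eq_right h]

theorem exists_proj_eq_self {x : X} (hx : x ∈ Submodule.span ℝ (Set.range b.basis)) :
    ∃ n, b.proj n x = x := by
  induction hx using Submodule.span_induction with
  | mem y hy =>
    obtain ⟨j, rfl⟩ := hy
    exact ⟨j + 1, by rw [proj_apply_basis_mem, if_pos (Nat.lt_succ_self j)]⟩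
  | zero => exact ⟨0, by simp⟩
  | add y z _ _ hy hz =>
    obtain ⟨m, hm⟩ := hy
    obtain ⟨k, hk⟩ := hz
    exact ⟨max m k, by rw [map_add, b.proj_eq_self_of_le (le_max_left _ _) hm,
      b.proj_eq_self_of_le (le_max_right _ _) hk]⟩
  | smul a y _ hy =>
    obtain ⟨m, hm⟩ := hy
    exact ⟨m, by rw [map_smul, hm]⟩

variable (hb : ∀ n x, ‖b.proj n x‖ ≤ ‖x‖)
include hb

theorem norm_sub_proj_le (n : ℕ) (x : X) : ‖x - b.proj n x‖ ≤ 2 * ‖x‖ :=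
  (norm_sub_le _ _).trans (by linarith [hb n x])

theorem norm_coord_mul_le (i : ℕ) (x : X) : ‖b.basis i‖ * |b.coord i x| ≤ 2 * ‖x‖ := by
  have h : b.coord i x • b.basis i = b.proj (i + 1) x - b.proj i x := by
    simp [proj_apply, Finset.sum_range_succ]
  calc ‖b.basis i‖ * |b.coord i x| = ‖b.coord i x • b.basis i‖ := by
        rw [norm_smul, mul_comm, Real.norm_eq_abs]
    _ ≤ ‖b.proj (i + 1) x‖ + ‖b.proj i x‖ := by rw [h]; exact norm_sub_le _ _
    _ ≤ 2 * ‖x‖ := by linarith [hb (i + 1) x, hb i x]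

omit hb in
theorem hasSum_quarter (c : ℝ) : HasSum (fun i : ℕ => 3 * (1 / 4 : ℝ) ^ (i + 1) * c) c := by
  have := (hasSum_geometric_of_lt_one (r := (1 / 4 : ℝ)) (by norm_num) (by norm_num)).mul_left
    (3 / 4 * c)
  rw [show 3 / 4 * c * (1 - 1 / 4)⁻¹ = c by field_simp; ring] at this
  refine (congrArg (HasSum · c) (funext fun i => ?_)).mp this
  ring

theorem sq_weighted_coord_le (i : ℕ) (x : X) :
    ‖(1 / 2 : ℝ) ^ (i + 2) * (‖b.basis i‖ * b.coord i x)‖ ^ 2 ≤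
      3 * (1 / 4 : ℝ) ^ (i + 1) * ‖x‖ ^ 2 := by
  have h := norm_coord_mul_le b hb i x
  have h0 : ‖(1 / 2 : ℝ) ^ (i + 2) * (‖b.basis i‖ * b.coord i x)‖ =
      (1 / 2 : ℝ) ^ (i + 2) * (‖b.basis i‖ * |b.coord i x|) := by
    simp
  have h4 : (1 / 4 : ℝ) ^ (i + 1) = ((1 / 2 : ℝ) ^ (i + 1)) ^ 2 := by
    rw [← pow_mul, mul_comm, pow_mul]; norm_num
  rw [h0, h4]
  calc ((1 / 2 : ℝ) ^ (i + 2) * (‖b.basis i‖ * |b.coord i x|)) ^ 2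
      ≤ ((1 / 2 : ℝ) ^ (i + 2) * (2 * ‖x‖)) ^ 2 := by gcongr
    _ = ((1 / 2 : ℝ) ^ (i + 1)) ^ 2 * ‖x‖ ^ 2 := by ring
    _ ≤ _ := by nlinarith [mul_nonneg (sq_nonneg ((1 / 2 : ℝ) ^ (i + 1))) (sq_nonneg ‖x‖)]

/-- The weighted coordinates of a vector, as an element of `ℓ²`. -/
noncomputable def toHilbert : X →ₗ[ℝ] lp (fun _ : ℕ => ℝ) 2 where
  toFun x := ⟨fun i => (1 / 2 : ℝ) ^ (i + 2) * (‖b.basis i‖ * b.coord i x),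
    lp.memℓp_two_of_summable <| Summable.of_nonneg_of_le (fun _ => sq_nonneg _)
      (fun i => sq_weighted_coord_le b hb i x) (hasSum_quarter _).summable⟩
  map_add' x y := by
    ext i
    change (1 / 2 : ℝ) ^ (i + 2) * (‖b.basis i‖ * b.coord i (x + y)) =
      (1 / 2 : ℝ) ^ (i + 2) * (‖b.basis i‖ * b.coord i x) +
      (1 / 2 : ℝ) ^ (i + 2) * (‖b.basis i‖ * b.coord i y)
    rw [map_add]; ring
  map_smul' c x := by
    ext i
    change (1 / 2 : ℝ) ^ (i + 2) * (‖b.basis i‖ * b.coord i (c • x)) =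
      c * ((1 / 2 : ℝ) ^ (i + 2) * (‖b.basis i‖ * b.coord i x))
    rw [map_smul, smul_eq_mul]; ring

theorem toHilbert_apply (x : X) (i : ℕ) :
    toHilbert b hb x i = (1 / 2 : ℝ) ^ (i + 2) * (‖b.basis i‖ * b.coord i x) := rfl

theorem norm_toHilbert_le (x : X) : ‖toHilbert b hb x‖ ≤ ‖x‖ :=
  lp.norm_le_of_hasSum_sq (norm_nonneg x) (hasSum_quarter _) fun i =>
    sq_weighted_coord_le b hb i x

theorem norm_toHilbert_proj_le (n : ℕ) (x : X) :
    ‖toHilbert b hb (b.proj n x)‖ ≤ ‖toHilbert b hb x‖ := by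
  refine lp.norm_le_norm_of_forall fun i => ?_
  rw [toHilbert_apply, toHilbert_apply, coord_proj]
  split_ifs
  · exact le_rfl
  · simp only [mul_zero, norm_zero]
    exact norm_nonneg _

theorem toHilbert_injective : Function.Injective (toHilbert b hb) := by
  refine (injective_iff_map_eq_zero _).2 fun x hx => b.eq_zero_of_coord fun i => ?_
  have h := toHilbert_apply b hb x i
  rw [hx] at h
  simpa [b.basis_ne_zero i] using h.symm

/-- A strictly convex seminorm which sees the tails of a vector. -/
noncomputable def tailNorm (x : X) : ℝ :=
  ∑' k : ℕ, 3 / 8 * (1 / 2 : ℝ) ^ (k + 1) * ‖x - b.proj (k + 1) x‖ +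
    1 / 4 * ‖toHilbert b hb x‖

omit hb in
theorem hasSum_half (c : ℝ) : HasSum (fun k : ℕ => (1 / 2 : ℝ) ^ (k + 1) * c) c := by
  have := (hasSum_geometric_of_lt_one (r := (1 / 2 : ℝ)) (by norm_num) (by norm_num)).mul_left
    (1 / 2 * c)
  rw [show 1 / 2 * c * (1 - 1 / 2)⁻¹ = c by field_simp; ring] at this
  refine (congrArg (HasSum · c) (funext fun i => ?_)).mp this
  ring

theorem tail_term_le (k : ℕ) (x : X) :
    3 / 8 * (1 / 2 : ℝ) ^ (k + 1) * ‖x - b.proj (k + 1) x‖ ≤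
      (1 / 2 : ℝ) ^ (k + 1) * (3 / 4 * ‖x‖) := by
  calc 3 / 8 * (1 / 2 : ℝ) ^ (k + 1) * ‖x - b.proj (k + 1) x‖
      ≤ 3 / 8 * (1 / 2 : ℝ) ^ (k + 1) * (2 * ‖x‖) := by
        gcongr; exact norm_sub_proj_le b hb _ x
    _ = _ := by ring

theorem summable_tail (x : X) :
    Summable fun k : ℕ => 3 / 8 * (1 / 2 : ℝ) ^ (k + 1) * ‖x - b.proj (k + 1) x‖ :=
  Summable.of_nonneg_of_le (fun _ => by positivity) (fun k => tail_term_le b hb k x)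
    (hasSum_half _).summable

theorem tailNorm_nonneg (x : X) : 0 ≤ tailNorm b hb x :=
  add_nonneg (tsum_nonneg fun _ => by positivity) (by positivity)

theorem tailNorm_le (x : X) : tailNorm b hb x ≤ ‖x‖ := by
  have h := hasSum_le (fun k => tail_term_le b hb k x) (summable_tail b hb x).hasSum
    (hasSum_half _)
  have := norm_toHilbert_le b hb x
  rw [tailNorm]; linarith

theorem tailNorm_smul (c : ℝ) (x : X) : tailNorm b hb (c • x) = |c| * tailNorm b hb x := by
  have h : ∀ k : ℕ, 3 / 8 * (1 / 2 : ℝ) ^ (k + 1) * ‖c • x - b.proj (k + 1) (c • x)‖ =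
      |c| * (3 / 8 * (1 / 2 : ℝ) ^ (k + 1) * ‖x - b.proj (k + 1) x‖) := fun k => by
    rw [map_smul, ← smul_sub, norm_smul, Real.norm_eq_abs]; ring
  rw [tailNorm, tailNorm, tsum_congr h, tsum_mul_left, map_smul, norm_smul, Real.norm_eq_abs]
  ring

/-- Keeps the Hilbert defect in the triangle inequality; this term is what later yields strict
convexity. -/
theorem tailNorm_add_le' (x y : X) : tailNorm b hb (x + y) +
    1 / 4 * (‖toHilbert b hb x‖ + ‖toHilbert b hb y‖ - ‖toHilbert b hb (x + y)‖) ≤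
      tailNorm b hb x + tailNorm b hb y := by
  have h : ∀ k : ℕ, 3 / 8 * (1 / 2 : ℝ) ^ (k + 1) * ‖x + y - b.proj (k + 1) (x + y)‖ ≤
      3 / 8 * (1 / 2 : ℝ) ^ (k + 1) * ‖x - b.proj (k + 1) x‖ +
      3 / 8 * (1 / 2 : ℝ) ^ (k + 1) * ‖y - b.proj (k + 1) y‖ := fun k => by
    rw [← mul_add, map_add, add_sub_add_comm]
    gcongr
    exact norm_add_le _ _
  have := hasSum_le h (summable_tail b hb (x + y)).hasSum
    ((summable_tail b hb x).hasSum.add (summable_tail b hb y).hasSum)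
  simp only [tailNorm]
  linarith

theorem tailNorm_add_le (x y : X) :
    tailNorm b hb (x + y) ≤ tailNorm b hb x + tailNorm b hb y := by
  have h := tailNorm_add_le' b hb x y
  have h2 := norm_add_le (toHilbert b hb x) (toHilbert b hb y)
  rw [← map_add] at h2
  linarith

/-- The n-th tail of P_n x vanishes, so that summand is gained in full; every other summand can only
shrink under P_n. -/
theorem tailNorm_proj_add_le {n : ℕ} (hn : 1 ≤ n) (x : X) :
    tailNorm b hb (b.proj n x) + 3 / 8 * (1 / 2 : ℝ) ^ n * ‖x - b.proj n x‖ ≤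
      tailNorm b hb x := by
  obtain ⟨m, rfl⟩ : ∃ m, n = m + 1 := ⟨n - 1, by omega⟩
  set d := 3 / 8 * (1 / 2 : ℝ) ^ (m + 1) * ‖x - b.proj (m + 1) x‖ with hd
  have h : ∀ k : ℕ, 3 / 8 * (1 / 2 : ℝ) ^ (k + 1) *
      ‖b.proj (m + 1) x - b.proj (k + 1) (b.proj (m + 1) x)‖ + (if k = m then d else 0) ≤
      3 / 8 * (1 / 2 : ℝ) ^ (k + 1) * ‖x - b.proj (k + 1) x‖ := fun k => by
    split_ifs with hk
    · subst hk
      rw [proj_comp, min_self, sub_self, norm_zero, mul_zero, zero_add]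
    · have : b.proj (m + 1) x - b.proj (k + 1) (b.proj (m + 1) x) =
          b.proj (m + 1) (x - b.proj (k + 1) x) := by
        rw [map_sub, proj_comp, proj_comp, min_comm]
      rw [add_zero, this]
      gcongr
      exact hb _ _
  have := hasSum_le h ((summable_tail b hb _).hasSum.add (hasSum_ite_eq m d))
    (summable_tail b hb x).hasSum
  have := norm_toHilbert_proj_le b hb (m + 1) x
  simp only [tailNorm]
  linarith

/-- The supremum of these seminorms is the new norm. -/
noncomputable def levelNorm (k : ℕ) (x : X) : ℝ :=
  ‖b.proj (k + 1) x‖ + (1 / 2 : ℝ) ^ (k + 1) * tailNorm b hb x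

/-- An equivalent norm for which the basis is strictly monotone in a quantitative way, and which is
strictly convex on the span of the basis. -/
noncomputable def strictNorm (x : X) : ℝ := ⨆ k, levelNorm b hb k x

/-- Levels start at P_1, so the factor of τ is at most 1/2. The resulting 3/2 matches the 3/8 in
`tailNorm`: 3/8 = 1/4 · 3/2. -/
theorem levelNorm_le (k : ℕ) (x : X) : levelNorm b hb k x ≤ 3 / 2 * ‖x‖ := by
  have h1 : (1 / 2 : ℝ) ^ (k + 1) ≤ 1 / 2 := by
    rw [pow_succ]; linarith [pow_le_one₀ (n := k) (by norm_num : (0 : ℝ) ≤ 1 / 2) (by norm_num)]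
  have h2 : (1 / 2 : ℝ) ^ (k + 1) * tailNorm b hb x ≤ 1 / 2 * ‖x‖ :=
    mul_le_mul h1 (tailNorm_le b hb x) (tailNorm_nonneg b hb x) (by norm_num)
  have := hb (k + 1) x
  rw [levelNorm]; linarith

theorem levelNorm_le_strictNorm (k : ℕ) (x : X) : levelNorm b hb k x ≤ strictNorm b hb x :=
  le_ciSup (f := fun k => levelNorm b hb k x)
    ⟨3 / 2 * ‖x‖, Set.forall_mem_range.2 fun k => levelNorm_le b hb k x⟩ k

theorem strictNorm_le (x : X) : strictNorm b hb x ≤ 3 / 2 * ‖x‖ :=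
  ciSup_le fun k => levelNorm_le b hb k x

theorem norm_le_strictNorm (x : X) : ‖x‖ ≤ strictNorm b hb x := by
  refine le_of_tendsto ((b.tendsto_proj x).comp (tendsto_add_atTop_nat 1)).norm
    (Eventually.of_forall fun k => le_trans ?_ (levelNorm_le_strictNorm b hb k x))
  exact le_add_of_nonneg_right (mul_nonneg (by positivity) (tailNorm_nonneg b hb x))

theorem levelNorm_add_le (k : ℕ) (x y : X) :
    levelNorm b hb k (x + y) ≤ levelNorm b hb k x + levelNorm b hb k y := by
  have h1 := norm_add_le (b.proj (k + 1) x) (b.proj (k + 1) y)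
  have h2 := mul_le_mul_of_nonneg_left (tailNorm_add_le b hb x y)
    (by positivity : 0 ≤ (1 / 2 : ℝ) ^ (k + 1))
  simp only [levelNorm, map_add]; linarith

theorem levelNorm_smul (k : ℕ) (c : ℝ) (x : X) :
    levelNorm b hb k (c • x) = |c| * levelNorm b hb k x := by
  simp only [levelNorm, map_smul, norm_smul, tailNorm_smul, Real.norm_eq_abs]; ring

/-- The new norm, bundled as a seminorm. -/
noncomputable def strictSeminorm : Seminorm ℝ X :=
  Seminorm.of (strictNorm b hb)
    (fun x y => ciSup_le fun k => (levelNorm_add_le b hb k x y).trans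
      (add_le_add (levelNorm_le_strictNorm b hb k x) (levelNorm_le_strictNorm b hb k y)))
    (fun c x => by
      simp only [strictNorm, levelNorm_smul, Real.norm_eq_abs]
      exact (Real.mul_iSup_of_nonneg (abs_nonneg c) _).symm)

/-- Once the projections fix x, the first term is stationary while the coefficient of τ decreases.
So on the span only finitely many levels compete. -/
theorem levelNorm_le_of_proj_eq {n k : ℕ} (hk : n ≤ k) {x : X} (hx : b.proj (n + 1) x = x) :
    levelNorm b hb k x ≤ levelNorm b hb n x := by
  rw [levelNorm, levelNorm, b.proj_eq_self_of_le (by omega : n + 1 ≤ k + 1) hx, hx]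
  have h : (1 / 2 : ℝ) ^ (k + 1) ≤ (1 / 2 : ℝ) ^ (n + 1) :=
    pow_le_pow_of_le_one (by norm_num) (by norm_num) (by omega)
  exact add_le_add_right (mul_le_mul_of_nonneg_right h (tailNorm_nonneg b hb x)) _

theorem strictNorm_proj_add_le {n : ℕ} (hn : 1 ≤ n) (x : X) :
    strictNorm b hb (b.proj n x) +
      (4 : ℝ) ^ (-(n : ℤ) - 1) * strictNorm b hb (x - b.proj n x) ≤ strictNorm b hb x := by
  obtain ⟨m, rfl⟩ : ∃ m, n = m + 1 := ⟨n - 1, by omega⟩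
  set g := ‖x - b.proj (m + 1) x‖ with hg
  have h4 : (4 : ℝ) ^ (-((m + 1 : ℕ) : ℤ) - 1) = 1 / 4 * ((1 / 2 : ℝ) ^ (m + 1)) ^ 2 := by
    rw [← pow_mul, mul_comm (m + 1) 2, pow_mul, zpow_sub₀ (by norm_num), zpow_neg, zpow_natCast]
    rw [show ((1 / 2 : ℝ) ^ 2) = 4⁻¹ by norm_num, inv_pow, zpow_one]
    ring
  have hgain : (4 : ℝ) ^ (-((m + 1 : ℕ) : ℤ) - 1) * strictNorm b hb (x - b.proj (m + 1) x) ≤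
      (1 / 2 : ℝ) ^ (m + 1) * (3 / 8 * (1 / 2 : ℝ) ^ (m + 1) * g) := by
    rw [h4]
    calc _ ≤ 1 / 4 * ((1 / 2 : ℝ) ^ (m + 1)) ^ 2 * (3 / 2 * g) := by
          gcongr; exact strictNorm_le b hb _
      _ = _ := by ring
  -- At levels up to n = m + 1 the first term is the same for x and P_n x, and the gain in τ is
  -- weighted by at least 2^{-n}. Higher levels of P_n x are dominated by level m.
  have hlow : ∀ k ≤ m, levelNorm b hb k (b.proj (m + 1) x) +
      (1 / 2 : ℝ) ^ (m + 1) * (3 / 8 * (1 / 2 : ℝ) ^ (m + 1) * g) ≤ strictNorm b hb x := by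
    intro k hk
    refine le_trans ?_ (levelNorm_le_strictNorm b hb k x)
    have h1 := tailNorm_proj_add_le b hb (Nat.le_add_left 1 m) x
    have h2 : (1 / 2 : ℝ) ^ (m + 1) ≤ (1 / 2 : ℝ) ^ (k + 1) :=
      pow_le_pow_of_le_one (by norm_num) (by norm_num) (by omega)
    have h3 : (1 / 2 : ℝ) ^ (m + 1) * (3 / 8 * (1 / 2 : ℝ) ^ (m + 1) * g) ≤
        (1 / 2 : ℝ) ^ (k + 1) * (3 / 8 * (1 / 2 : ℝ) ^ (m + 1) * g) :=
      mul_le_mul_of_nonneg_right h2 (by positivity)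
    have h5 := mul_le_mul_of_nonneg_left h1 (by positivity : 0 ≤ (1 / 2 : ℝ) ^ (k + 1))
    rw [levelNorm, levelNorm, proj_comp, min_eq_left (by omega)]
    rw [mul_add] at h5
    linarith
  have hproj : b.proj (m + 1) (b.proj (m + 1) x) = b.proj (m + 1) x := by
    rw [proj_comp, min_self]
  suffices h : strictNorm b hb (b.proj (m + 1) x) ≤ strictNorm b hb x -
      (1 / 2 : ℝ) ^ (m + 1) * (3 / 8 * (1 / 2 : ℝ) ^ (m + 1) * g) by linarith
  refine ciSup_le fun k => ?_
  rcases le_total k m with hk | hk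
  · linarith [hlow k hk]
  · linarith [hlow m le_rfl, levelNorm_le_of_proj_eq b hb hk hproj]

theorem strictNorm_proj_le (n : ℕ) (x : X) : strictNorm b hb (b.proj n x) ≤ strictNorm b hb x := by
  rcases Nat.eq_zero_or_pos n with rfl | hn
  · have h0 : strictNorm b hb 0 = 0 :=
      le_antisymm (by simpa using strictNorm_le b hb 0) (by simpa using norm_le_strictNorm b hb 0)
    simpa [h0] using (norm_nonneg x).trans (norm_le_strictNorm b hb x)
  · have h := strictNorm_proj_add_le b hb hn x
    have : 0 ≤ strictNorm b hb (x - b.proj n x) :=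
      (norm_nonneg _).trans (norm_le_strictNorm b hb _)
    have : 0 ≤ (4 : ℝ) ^ (-(n : ℤ) - 1) * strictNorm b hb (x - b.proj n x) := by positivity
    linarith

theorem exists_strictNorm_eq_levelNorm {x : X} (hx : x ∈ Submodule.span ℝ (Set.range b.basis)) :
    ∃ k, strictNorm b hb x = levelNorm b hb k x := by
  obtain ⟨n, hn⟩ := b.exists_proj_eq_self hx
  obtain ⟨k, -, hk⟩ := Finset.exists_max_image (Finset.range (n + 1))
    (fun k => levelNorm b hb k x) ⟨0, by simp⟩
  refine ⟨k, le_antisymm (ciSup_le fun j => ?_) (levelNorm_le_strictNorm b hb k x)⟩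
  rcases le_total j n with hj | hj
  · exact hk j (by simp; omega)
  · exact (levelNorm_le_of_proj_eq b hb hj (b.proj_eq_self_of_le (Nat.le_succ n) hn)).trans
      (hk n (by simp))

/-- At a level attaining the norm of x + y, equality forces the Hilbert defect to vanish; Hilbert
space is strictly convex and `toHilbert` is injective. -/
theorem sameRay_of_strictNorm_add {x y : X} (hx : x ∈ Submodule.span ℝ (Set.range b.basis))
    (hy : y ∈ Submodule.span ℝ (Set.range b.basis))
    (h : strictNorm b hb x + strictNorm b hb y ≤ strictNorm b hb (x + y)) : SameRay ℝ x y := by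
  obtain ⟨k, hk⟩ := exists_strictNorm_eq_levelNorm b hb (Submodule.add_mem _ hx hy)
  have h1 := levelNorm_le_strictNorm b hb k x
  have h2 := levelNorm_le_strictNorm b hb k y
  have h3 := norm_add_le (b.proj (k + 1) x) (b.proj (k + 1) y)
  have h4 := tailNorm_add_le' b hb x y
  simp only [levelNorm, map_add] at hk h1 h2
  have h5 : (1 / 2 : ℝ) ^ (k + 1) * (tailNorm b hb x + tailNorm b hb y) ≤
      (1 / 2 : ℝ) ^ (k + 1) * tailNorm b hb (x + y) := by rw [mul_add]; linarith
  have h6 := le_of_mul_le_mul_left h5 (by positivity)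
  rw [map_add] at h4
  have h7 : ‖toHilbert b hb x + toHilbert b hb y‖ = ‖toHilbert b hb x‖ + ‖toHilbert b hb y‖ :=
    le_antisymm (norm_add_le _ _) (by linarith)
  exact (toHilbert_injective b hb).sameRay_map_iff.1 (sameRay_iff_norm_add.2 h7)

/-- The slack 2^{-k} in the partial sums absorbs exactly the added term 2^{-k} τ(x). -/
theorem strictNorm_le_one {x : X} (hx : ‖x‖ ≤ 1)
    (h : ∀ k, ‖b.proj k x‖ ≤ 1 - (1 / 2 : ℝ) ^ k) : strictNorm b hb x ≤ 1 := by
  refine ciSup_le fun k => ?_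
  have h1 : (1 / 2 : ℝ) ^ (k + 1) * tailNorm b hb x ≤ (1 / 2 : ℝ) ^ (k + 1) :=
    mul_le_of_le_one_right (by positivity) ((tailNorm_le b hb x).trans hx)
  rw [levelNorm]; linarith [h (k + 1)]

end SchauderBasis

namespace SchauderBasis

/-! ### The dual basis -/

section Dual

variable {X : Type*} [NormedAddCommGroup X] [NormedSpace ℝ X] (b : SchauderBasis ℝ X)

theorem coord_mem_dualBasisClosedSpan (i : ℕ) : b.coord i ∈ dualBasisClosedSpan b :=
  subset_closure (Submodule.subset_span ⟨i, rfl⟩)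

theorem isClosed_dualBasisClosedSpan :
    IsClosed (dualBasisClosedSpan b : Set (StrongDual ℝ X)) :=
  Submodule.isClosed_topologicalClosure _

/-- The coordinate functionals of a monotone basis form a basis of their closed span. -/
noncomputable def dualBasis (hb : ∀ n x, ‖b.proj n x‖ ≤ ‖x‖) :
    SchauderBasis ℝ (dualBasisClosedSpan b) :=
  ofDense (fun i => ⟨b.coord i, b.coord_mem_dualBasisClosedSpan i⟩)
    (fun i => (ContinuousLinearMap.apply ℝ ℝ (b.basis i)).comp (dualBasisClosedSpan b).subtypeL)
    (fun i j => by simp [ortho_ite, eq_comm])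
    (fun n φ => by
      refine ContinuousLinearMap.opNorm_le_bound _ (norm_nonneg φ) fun x => ?_
      have h : (∑ i ∈ Finset.range n, ((ContinuousLinearMap.apply ℝ ℝ (b.basis i)).comp
          (dualBasisClosedSpan b).subtypeL) φ •
          (⟨b.coord i, b.coord_mem_dualBasisClosedSpan i⟩ : dualBasisClosedSpan b) :
          dualBasisClosedSpan b).1 x = φ.1 (b.proj n x) := by
        simp [proj_apply, mul_comm]
      exact h ▸ (φ.1.le_opNorm _).trans (mul_le_mul_of_nonneg_left (hb n x) (norm_nonneg φ.1)))
    (fun φ => by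
      rw [closure_subtype]
      refine closure_mono ?_ φ.2
      intro ψ hψ
      have h : Submodule.span ℝ (Set.range b.coord) ≤ (Submodule.span ℝ (Set.range fun i =>
          (⟨b.coord i, b.coord_mem_dualBasisClosedSpan i⟩ : dualBasisClosedSpan b))).map
          (dualBasisClosedSpan b).subtype := by
        rw [Submodule.map_span, ← Set.range_comp]
        exact le_rfl
      exact h hψ)

variable (hb : ∀ n x, ‖b.proj n x‖ ≤ ‖x‖)

theorem dualBasis_basis (i : ℕ) : ((b.dualBasis hb).basis i).1 = b.coord i := rfl

theorem dualBasis_coord (i : ℕ) (φ : dualBasisClosedSpan b) :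
    (b.dualBasis hb).coord i φ = φ.1 (b.basis i) := rfl

theorem dualBasis_proj (n : ℕ) (φ : dualBasisClosedSpan b) (x : X) :
    ((b.dualBasis hb).proj n φ).1 x = φ.1 (b.proj n x) := by
  simp [proj_apply, dualBasis_basis, dualBasis_coord, mul_comm]

theorem norm_dualBasis_proj_le (n : ℕ) (φ : dualBasisClosedSpan b) :
    ‖(b.dualBasis hb).proj n φ‖ ≤ ‖φ‖ := by
  refine ContinuousLinearMap.opNorm_le_bound _ (norm_nonneg φ) fun x => ?_
  change ‖((b.dualBasis hb).proj n φ).1 x‖ ≤ _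
  rw [dualBasis_proj]
  exact (φ.1.le_opNorm _).trans (mul_le_mul_of_nonneg_left (hb n x) (norm_nonneg φ.1))

end Dual

/-! ### Interleaved bases of products -/

section Prod

variable {X : Type*} [NormedAddCommGroup X] [NormedSpace ℝ X] (b : SchauderBasis ℝ X)
variable {Y : Type*} [NormedAddCommGroup Y] [NormedSpace ℝ Y] (c : SchauderBasis ℝ Y)

/-- The vectors of the interleaved basis of a product. -/
def prodVec (n : ℕ) : X × Y :=
  if n % 2 = 0 then (b.basis (n / 2), 0) else (0, c.basis (n / 2))

/-- The coordinate functionals of the interleaved basis of a product. -/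
noncomputable def prodCoord (n : ℕ) : StrongDual ℝ (X × Y) :=
  if n % 2 = 0 then (b.coord (n / 2)).comp (ContinuousLinearMap.fst ℝ X Y)
  else (c.coord (n / 2)).comp (ContinuousLinearMap.snd ℝ X Y)

theorem sum_prodVec (n : ℕ) (z : X × Y) :
    ∑ i ∈ Finset.range n, prodCoord b c i z • prodVec b c i =
      (b.proj ((n + 1) / 2) z.1, c.proj (n / 2) z.2) := by
  induction n with
  | zero => simp [Prod.zero_eq_mk]
  | succ n ih =>
    rw [Finset.sum_range_succ, ih]
    rcases Nat.even_or_odd' n with ⟨m, rfl | rfl⟩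
    · have h1 : (2 * m + 1 + 1) / 2 = m + 1 := by omega
      have h2 : (2 * m + 1) / 2 = m := by omega
      have h3 : 2 * m / 2 = m := by omega
      simp [prodCoord, prodVec, h1, h2, h3, proj_apply, Finset.sum_range_succ]
    · have h1 : (2 * m + 1 + 1) / 2 = m + 1 := by omega
      have h2 : (2 * m + 1 + 1 + 1) / 2 = m + 1 := by omega
      have h3 : (2 * m + 1) / 2 = m := by omega
      have h4 : (2 * m + 1) % 2 = 1 := by omega
      simp [prodCoord, prodVec, h1, h2, h3, h4, proj_apply, Finset.sum_range_succ]

/-- The interleaved basis of a product. -/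
noncomputable def prod : SchauderBasis ℝ (X × Y) :=
  ofTendsto (prodVec b c) (prodCoord b c)
    (fun i j => by
      rcases Nat.mod_two_eq_zero_or_one i with hi | hi <;>
      rcases Nat.mod_two_eq_zero_or_one j with hj | hj
      · have : i / 2 = j / 2 ↔ i = j := by omega
        simp [prodVec, prodCoord, hi, hj, ortho_ite, this]
      · have : i ≠ j := by omega
        simp [prodVec, prodCoord, hi, hj, this]
      · have : i ≠ j := by omega
        simp [prodVec, prodCoord, hi, hj, this]
      · have : i / 2 = j / 2 ↔ i = j := by omega
        simp [prodVec, prodCoord, hi, hj, ortho_ite, this])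
    fun z => by
      simp only [sum_prodVec]
      have h1 : Tendsto (fun n : ℕ => n / 2) atTop atTop :=
        Nat.tendsto_div_const_atTop (by norm_num)
      exact ((b.tendsto_proj z.1).comp (h1.comp (tendsto_add_atTop_nat 1))).prodMk_nhds
        ((c.tendsto_proj z.2).comp h1)

theorem prod_proj (n : ℕ) (z : X × Y) :
    (prod b c).proj n z = (b.proj ((n + 1) / 2) z.1, c.proj (n / 2) z.2) := by
  rw [proj_apply]; exact sum_prodVec b c n z

theorem prod_coord_odd (i : ℕ) (z : X × Y) : (prod b c).coord (2 * i + 1) z = c.coord i z.2 := by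
  have h3 : (2 * i + 1) / 2 = i := by omega
  have h4 : (2 * i + 1) % 2 = 1 := by omega
  change prodCoord b c (2 * i + 1) z = _
  simp [prodCoord, h3, h4]

end Prod

/-! ### Bases of ℓ² sums -/

section Sum

variable {W : Type*} [NormedAddCommGroup W] [NormedSpace ℝ W] (b : SchauderBasis ℝ W)

/-- The vectors of the basis of an `ℓ²` sum of copies of `W`. -/
noncomputable def sumVec (n : ℕ) : lp (fun _ : ℕ => W) 2 :=
  lp.single 2 n.unpair.1 (b.basis n.unpair.2)

/-- The coordinate functionals of the basis of an `ℓ²` sum of copies of `W`. -/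
noncomputable def sumCoord (n : ℕ) : StrongDual ℝ (lp (fun _ : ℕ => W) 2) :=
  (b.coord n.unpair.2).comp (lp.evalCLM ℝ (fun _ : ℕ => W) 2 n.unpair.1)

theorem sumCoord_apply (n : ℕ) (f : lp (fun _ : ℕ => W) 2) :
    sumCoord b n f = b.coord n.unpair.2 (f n.unpair.1) := rfl

/-- Pairing is increasing in its second argument, so the indices below n that fall in block j form
an initial segment of that block. -/
theorem exists_sum_sumVec (j n : ℕ) : ∃ m, (∀ i, i < m ↔ Nat.pair j i < n) ∧
    ∀ f : lp (fun _ : ℕ => W) 2,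
      (∑ i ∈ Finset.range n, sumCoord b i f • sumVec b i : lp (fun _ : ℕ => W) 2) j =
        b.proj m (f j) := by
  induction n with
  | zero => exact ⟨0, fun i => by simp, fun f => by simp⟩
  | succ n ih =>
    obtain ⟨m, hm, hf⟩ := ih
    by_cases hj : n.unpair.1 = j
    · have hn : Nat.pair j n.unpair.2 = n := by rw [← hj, Nat.pair_unpair]
      have hlt : ∀ i, Nat.pair j i < n ↔ i < n.unpair.2 := fun i => by
        rw [← hn, Nat.unpair_pair]
        exact ⟨fun h => by
          by_contra h'
          exact absurd (StrictMono.monotone (fun _ _ => Nat.pair_lt_pair_right j) (not_lt.1 h'))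
            (not_le.2 h), Nat.pair_lt_pair_right j⟩
      have hmn : m = n.unpair.2 := by
        refine Nat.le_antisymm (Nat.le_of_not_lt fun h => ?_) (Nat.le_of_not_lt fun h => ?_)
        · exact absurd ((hm _).1 h) (by rw [hn]; exact lt_irrefl n)
        · exact absurd ((hm m).2 ((hlt m).2 h)) (lt_irrefl m)
      refine ⟨m + 1, fun i => ?_, fun f => ?_⟩
      · rw [Nat.lt_succ_iff_lt_or_eq, Nat.lt_succ_iff_lt_or_eq, hm]
        refine or_congr Iff.rfl ⟨fun h => by rw [h, hmn, hn], fun h => ?_⟩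
        rw [hmn, ← h, Nat.unpair_pair]
      · rw [Finset.sum_range_succ, lp.coeFn_add, Pi.add_apply, hf, lp.coeFn_smul, Pi.smul_apply,
          sumCoord_apply, sumVec, hj, lp.single_apply_self, ← hmn]
        simp [proj_apply, Finset.sum_range_succ]
    · refine ⟨m, fun i => ?_, fun f => ?_⟩
      · rw [hm, Nat.lt_succ_iff_lt_or_eq]
        refine ⟨Or.inl, fun h => h.resolve_right fun h => hj ?_⟩
        rw [← h, Nat.unpair_pair]
      · rw [Finset.sum_range_succ, lp.coeFn_add, Pi.add_apply, hf, lp.coeFn_smul, Pi.smul_apply,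
          sumVec, lp.single_apply_ne _ _ _ (Ne.symm hj), smul_zero, add_zero]

variable (hb : ∀ n x, ‖b.proj n x‖ ≤ ‖x‖)

/-- A monotone basis of `W` induces a basis of the `ℓ²` sum of copies of `W`. -/
noncomputable def sum : SchauderBasis ℝ (lp (fun _ : ℕ => W) 2) :=
  ofDense (sumVec b) (sumCoord b)
    (fun i j => by
      rw [sumCoord_apply, sumVec]
      by_cases h : i.unpair.1 = j.unpair.1
      · rw [h, lp.single_apply_self, ortho_ite]
        have : i.unpair.2 = j.unpair.2 ↔ i = j :=
          ⟨fun h2 => by rw [← Nat.pair_unpair i, h, h2, Nat.pair_unpair], fun h2 => by rw [h2]⟩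
        simp only [this]
      · rw [lp.single_apply_ne _ _ _ h, map_zero, if_neg]
        rintro rfl; exact h rfl)
    (fun n f => lp.norm_le_norm_of_forall fun j => by
      obtain ⟨m, -, hm⟩ := exists_sum_sumVec b j n
      rw [hm]; exact hb m _)
    (fun f => by
      set p := (Submodule.span ℝ (Set.range (sumVec b))).topologicalClosure
      have hp : IsClosed (p : Set (lp (fun _ : ℕ => W) 2)) :=
        Submodule.isClosed_topologicalClosure _
      have h : ∀ j x, lp.single 2 j x ∈ p := fun j x =>
        b.mem_of_basis_mem (lp.singleContinuousLinearMap ℝ (fun _ : ℕ => W) 2 j) p hp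
          (fun i => subset_closure (Submodule.subset_span
            ⟨Nat.pair j i, by simp [sumVec]⟩)) x
      exact hp.mem_of_tendsto (lp.hasSum_single (by norm_num) f)
        (Eventually.of_forall fun s => Submodule.sum_mem _ fun j _ => h j (f j)))

theorem sum_coord (n : ℕ) (f : lp (fun _ : ℕ => W) 2) :
    (b.sum hb).coord n f = b.coord n.unpair.2 (f n.unpair.1) := rfl

theorem sum_proj (n j : ℕ) : ∃ m, ((n ≤ j) → m = 0) ∧
    ∀ f, ((b.sum hb).proj n f) j = b.proj m (f j) := by
  obtain ⟨m, h1, h2⟩ := exists_sum_sumVec b j n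
  refine ⟨m, fun hn => ?_, fun f => by rw [proj_apply]; exact h2 f⟩
  by_contra h
  have := (h1 0).1 (Nat.pos_of_ne_zero h)
  -- Since j ≤ `Nat.pair j 0`, the first n basis vectors lie in the blocks below n.
  exact absurd (Nat.left_le_pair j 0) (by omega)

theorem norm_sum_proj_apply_le (n j : ℕ) (f : lp (fun _ : ℕ => W) 2) :
    ‖((b.sum hb).proj n f) j‖ ≤ ‖f j‖ := by
  obtain ⟨m, -, h⟩ := sum_proj b hb n j
  rw [h]; exact hb m _

theorem sum_proj_apply_of_le {n j : ℕ} (h : n ≤ j) (f : lp (fun _ : ℕ => W) 2) :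
    ((b.sum hb).proj n f) j = 0 := by
  obtain ⟨m, hm, hf⟩ := sum_proj b hb n j
  rw [hf, hm h]; simp

theorem norm_sum_proj_le (n : ℕ) (f : lp (fun _ : ℕ => W) 2) : ‖(b.sum hb).proj n f‖ ≤ ‖f‖ :=
  lp.norm_le_norm_of_forall fun j => norm_sum_proj_apply_le b hb n j f

end Sum

end SchauderBasis

/-! ### Weights and the weighted diagonal -/

/-- A square summable sequence of weights with sum of squares `1`. -/
noncomputable def sumWeight (j : ℕ) : ℝ := 5 / 13 * (12 / 13) ^ j

theorem sumWeight_pos (j : ℕ) : 0 < sumWeight j := by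
  unfold sumWeight; positivity

theorem sumWeight_sq (j : ℕ) : sumWeight j ^ 2 = 25 / 169 * (144 / 169) ^ j := by
  rw [sumWeight, mul_pow, ← pow_mul, mul_comm j 2, pow_mul]; norm_num

theorem hasSum_sumWeight_sq : HasSum (fun j => sumWeight j ^ 2) 1 := by
  have h := (hasSum_geometric_of_lt_one (r := (144 / 169 : ℝ)) (by norm_num) (by norm_num)).mul_left
    (25 / 169)
  simp only [sumWeight_sq]
  norm_num at h ⊢
  exact h

theorem summable_sumWeight : Summable sumWeight :=
  (summable_geometric_of_lt_one (by norm_num) (by norm_num)).mul_left _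

/-- The induction needs only a ratio of at least 3/4. The triple 5, 12, 13 provides one with
rational weights whose squares sum to 1. -/
theorem two_mul_sub_sq_le (n : ℕ) :
    2 * (1 / 2 : ℝ) ^ n - ((1 / 2 : ℝ) ^ n) ^ 2 ≤ (144 / 169) ^ n := by
  induction n with
  | zero => norm_num
  | succ n ih =>
    have h0 : 0 < (1 / 2 : ℝ) ^ n := by positivity
    have h1 : (1 / 2 : ℝ) ^ n ≤ 1 := pow_le_one₀ (by norm_num) (by norm_num)
    have h2 : (0 : ℝ) ≤ (144 / 169) ^ n := by positivity
    rw [pow_succ, pow_succ (144 / 169 : ℝ)]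
    nlinarith

theorem sum_sumWeight_sq_le (n : ℕ) :
    ∑ j ∈ Finset.range n, sumWeight j ^ 2 ≤ (1 - (1 / 2 : ℝ) ^ n) ^ 2 := by
  have h : ∑ j ∈ Finset.range n, sumWeight j ^ 2 = 1 - (144 / 169) ^ n := by
    simp only [sumWeight_sq]
    rw [← Finset.mul_sum, geom_sum_eq (by norm_num)]
    ring
  rw [h]
  nlinarith [two_mul_sub_sq_le n]

theorem one_sub_half_pow_nonneg (n : ℕ) : (0 : ℝ) ≤ 1 - (1 / 2) ^ n :=
  sub_nonneg.2 (pow_le_one₀ (by norm_num) (by norm_num))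

theorem one_sub_half_pow_mono {m n : ℕ} (h : m ≤ n) : (1 : ℝ) - (1 / 2) ^ m ≤ 1 - (1 / 2) ^ n :=
  sub_le_sub_left (pow_le_pow_of_le_one (by norm_num) (by norm_num) h) 1

namespace SchauderBasis

section Weighted

variable {W : Type*} [NormedAddCommGroup W] [NormedSpace ℝ W]

theorem hasSum_norm_sq_smul (x : W) : HasSum (fun j => ‖sumWeight j • x‖ ^ 2) (‖x‖ ^ 2) := by
  have h := hasSum_sumWeight_sq.mul_right (‖x‖ ^ 2)
  rw [one_mul] at h
  refine (congrArg (HasSum · (‖x‖ ^ 2)) (funext fun j => ?_)).mp h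
  rw [norm_smul, mul_pow, Real.norm_eq_abs, sq_abs]

variable (W) in
/-- The weighted diagonal embedding of `W` into an `ℓ²` sum of copies of `W`. -/
noncomputable def diagonal : W →ₗᵢ[ℝ] lp (fun _ : ℕ => W) 2 where
  toFun x := ⟨fun j => sumWeight j • x, lp.memℓp_two_of_summable (hasSum_norm_sq_smul x).summable⟩
  map_add' x y := by ext j; exact smul_add _ x y
  map_smul' c x := by ext j; exact smul_comm _ c x
  norm_map' x := by
    refine (sq_eq_sq₀ (norm_nonneg _) (norm_nonneg _)).1 ?_
    exact (lp.hasSum_norm_sq _).unique (hasSum_norm_sq_smul x)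

theorem diagonal_apply (x : W) (j : ℕ) : diagonal W x j = sumWeight j • x := rfl

variable [CompleteSpace W]

variable (W) in
theorem summable_codiagonal :
    Summable fun j => sumWeight j • lp.evalCLM ℝ (fun _ : ℕ => W) 2 j := by
  refine Summable.of_norm_bounded summable_sumWeight fun j => ?_
  refine ContinuousLinearMap.opNorm_le_bound _ (sumWeight_pos j).le fun f => ?_
  change ‖sumWeight j • f j‖ ≤ _
  rw [norm_smul, Real.norm_of_nonneg (sumWeight_pos j).le]
  exact mul_le_mul_of_nonneg_left (lp.norm_apply_le_norm (by norm_num) f j) (sumWeight_pos j).le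

variable (W) in
/-- The weighted sum map, a left inverse of the weighted diagonal embedding. -/
noncomputable def codiagonal : lp (fun _ : ℕ => W) 2 →L[ℝ] W :=
  ∑' j, sumWeight j • lp.evalCLM ℝ (fun _ : ℕ => W) 2 j

theorem hasSum_codiagonal (f : lp (fun _ : ℕ => W) 2) :
    HasSum (fun j => sumWeight j • f j) (codiagonal W f) :=
  (summable_codiagonal W).hasSum.mapL (ContinuousLinearMap.apply ℝ W f)

theorem codiagonal_diagonal (x : W) : codiagonal W (diagonal W x) = x := by
  refine (hasSum_codiagonal _).unique ?_
  have h := hasSum_sumWeight_sq.smul_const x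
  rw [one_smul] at h
  refine (congrArg (HasSum · x) (funext fun j => ?_)).mp h
  rw [diagonal_apply, smul_smul, sq]

variable (b : SchauderBasis ℝ W) (hb : ∀ n x, ‖b.proj n x‖ ≤ ‖x‖)

omit [CompleteSpace W] in
theorem norm_proj_diagonal_le (n : ℕ) (x : W) :
    ‖(b.sum hb).proj n (diagonal W x)‖ ≤ (1 - (1 / 2) ^ n) * ‖x‖ := by
  have h0 := one_sub_half_pow_nonneg n
  refine abs_le_of_sq_le_sq' ?_ (by positivity) |>.2
  have h := lp.hasSum_norm_sq ((b.sum hb).proj n (diagonal W x))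
  rw [h.unique (hasSum_sum_of_ne_finset_zero (s := Finset.range n) fun j hj => by
    rw [sum_proj_apply_of_le b hb (by simpa using hj)]; simp)]
  calc ∑ j ∈ Finset.range n, ‖((b.sum hb).proj n (diagonal W x)) j‖ ^ 2
      ≤ ∑ j ∈ Finset.range n, sumWeight j ^ 2 * ‖x‖ ^ 2 := by
        gcongr with j
        have := norm_sum_proj_apply_le b hb n j (diagonal W x)
        rw [diagonal_apply, norm_smul, Real.norm_of_nonneg (sumWeight_pos j).le] at this
        rw [← mul_pow]
        gcongr
    _ ≤ (1 - (1 / 2) ^ n) ^ 2 * ‖x‖ ^ 2 := by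
        rw [← Finset.sum_mul]; gcongr; exact sum_sumWeight_sq_le n
    _ = _ := by ring

/-- Only blocks below n survive, and Cauchy–Schwarz against the first n weights gives the factor. -/
theorem norm_codiagonal_proj_le (n : ℕ) (f : lp (fun _ : ℕ => W) 2) :
    ‖codiagonal W ((b.sum hb).proj n f)‖ ≤ (1 - (1 / 2) ^ n) * ‖f‖ := by
  have h0 := one_sub_half_pow_nonneg n
  rw [(hasSum_codiagonal _).unique (hasSum_sum_of_ne_finset_zero (s := Finset.range n) fun j hj => by
    rw [sum_proj_apply_of_le b hb (by simpa using hj)]; simp)]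
  have h1 : ‖∑ j ∈ Finset.range n, sumWeight j • ((b.sum hb).proj n f) j‖ ≤
      ∑ j ∈ Finset.range n, sumWeight j * ‖f j‖ := by
    refine norm_sum_le_of_le _ fun j _ => ?_
    rw [norm_smul, Real.norm_of_nonneg (sumWeight_pos j).le]
    exact mul_le_mul_of_nonneg_left (norm_sum_proj_apply_le b hb n j f) (sumWeight_pos j).le
  refine h1.trans (abs_le_of_sq_le_sq' ?_ (by positivity) |>.2)
  calc (∑ j ∈ Finset.range n, sumWeight j * ‖f j‖) ^ 2
      ≤ (∑ j ∈ Finset.range n, sumWeight j ^ 2) * ∑ j ∈ Finset.range n, ‖f j‖ ^ 2 :=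
        Finset.sum_mul_sq_le_sq_mul_sq _ _ _
    _ ≤ (1 - (1 / 2) ^ n) ^ 2 * ‖f‖ ^ 2 := by
        gcongr
        · exact sum_sumWeight_sq_le n
        · exact sum_le_hasSum _ (fun _ _ => by positivity) (lp.hasSum_norm_sq f)
    _ = _ := by ring

theorem norm_codiagonal_le (f : lp (fun _ : ℕ => W) 2) (b : SchauderBasis ℝ W)
    (hb : ∀ n x, ‖b.proj n x‖ ≤ ‖x‖) : ‖codiagonal W f‖ ≤ ‖f‖ := by
  refine le_of_tendsto
    (((codiagonal W).continuous.tendsto f).comp ((b.sum hb).tendsto_proj f)).norm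
    (Eventually.of_forall fun n => (norm_codiagonal_proj_le b hb n f).trans ?_)
  exact mul_le_of_le_one_left (norm_nonneg f) (sub_le_self _ (by positivity))

/-- The weights are summable, not just square summable, so the series for `codiagonal` converges in
operator norm and its composition with a coordinate is a norm limit of coordinate combinations. -/
theorem coord_comp_codiagonal_mem (i : ℕ) :
    (b.coord i).comp (codiagonal W) ∈ dualBasisClosedSpan (b.sum hb) := by
  have h := (summable_codiagonal W).hasSum.mapL
    (ContinuousLinearMap.compL ℝ (lp (fun _ : ℕ => W) 2) W ℝ (b.coord i))
  refine (b.sum hb).isClosed_dualBasisClosedSpan.mem_of_tendsto h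
    (Eventually.of_forall fun s => Submodule.sum_mem _ fun j _ => ?_)
  have h2 : ContinuousLinearMap.compL ℝ (lp (fun _ : ℕ => W) 2) W ℝ (b.coord i)
      (sumWeight j • lp.evalCLM ℝ (fun _ : ℕ => W) 2 j) =
      sumWeight j • (b.sum hb).coord (Nat.pair j i) := by
    ext f
    rw [_root_.smul_apply, sum_coord, Nat.unpair_pair]
    exact (b.coord i).map_smul _ _
  rw [h2]
  exact Submodule.smul_mem _ _ (coord_mem_dualBasisClosedSpan _ _)

theorem comp_proj_comp_codiagonal_mem (ψ : StrongDual ℝ W) (n : ℕ) :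
    (ψ.comp (b.proj n)).comp (codiagonal W) ∈ dualBasisClosedSpan (b.sum hb) := by
  have h : (ψ.comp (b.proj n)).comp (codiagonal W) =
      ∑ i ∈ Finset.range n, ψ (b.basis i) • (b.coord i).comp (codiagonal W) := by
    ext f
    simp [proj_apply, mul_comm]
  rw [h]
  exact Submodule.sum_mem _ fun i _ => Submodule.smul_mem _ _ (coord_comp_codiagonal_mem b hb i)

end Weighted

end SchauderBasis

/-! ### Renorming by an equivalent seminorm -/

/-- A copy of a normed space, to be normed by a given seminorm. -/
def Renormed {E : Type v} [NormedAddCommGroup E] [NormedSpace ℝ E] (_ : Seminorm ℝ E) : Type v := E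

namespace Renormed

variable {E : Type v} [NormedAddCommGroup E] [NormedSpace ℝ E] (p : Seminorm ℝ E)

instance : AddCommGroup (Renormed p) := inferInstanceAs (AddCommGroup E)

instance : Module ℝ (Renormed p) := inferInstanceAs (Module ℝ E)

instance : Norm (Renormed p) := ⟨fun x => p (show E from x)⟩

/-- The identity map from a normed space to its renormed copy. -/
def equiv : E ≃ₗ[ℝ] Renormed p := LinearEquiv.refl ℝ E

theorem core (h : ∀ x, ‖x‖ ≤ p x) : NormedSpace.Core ℝ (Renormed p) where
  norm_nonneg x := apply_nonneg p _
  norm_smul c x := map_smul_eq_mul p c _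
  norm_triangle x y := map_add_le_add p _ _
  norm_eq_zero_iff x :=
    ⟨fun hx => norm_le_zero_iff.1 ((h x).trans_eq hx), fun hx => by rw [hx]; exact map_zero p⟩

end Renormed

theorem Seminorm.exists_renorming {E : Type v} [NormedAddCommGroup E] [NormedSpace ℝ E]
    [CompleteSpace E] (p : Seminorm ℝ E) (C : ℝ) (h1 : ∀ x, ‖x‖ ≤ p x) (h2 : ∀ x, p x ≤ C * ‖x‖) :
    ∃ (F : Type v) (_ : NormedAddCommGroup F) (_ : NormedSpace ℝ F) (_ : CompleteSpace F)
      (T : E ≃L[ℝ] F), ∀ x, ‖T x‖ = p x := by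
  let i1 : NormedAddCommGroup (Renormed p) := NormedAddCommGroup.ofCore (Renormed.core p h1)
  let i2 : NormedSpace ℝ (Renormed p) := NormedSpace.ofCore (Renormed.core p h1)
  let T : E ≃L[ℝ] Renormed p := (Renormed.equiv p).toContinuousLinearEquivOfBounds C 1 h2
    fun x => (one_mul ‖x‖).symm ▸ h1 ((Renormed.equiv p).symm x)
  exact ⟨Renormed p, i1, i2, (completeSpace_congr (e := T.toEquiv) T.isUniformEmbedding).1 inferInstance, T,
    fun x => rfl⟩

theorem IsometricallyUniversal.of_isometry {E : Type v} [NormedAddCommGroup E] [NormedSpace ℝ E]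
    {F : Type v} [NormedAddCommGroup F] [NormedSpace ℝ F] (hE : IsometricallyUniversal.{u} E)
    (T : E →ₗᵢ[ℝ] F) : IsometricallyUniversal.{u} F := fun X _ _ _ _ =>
  (hE X).map T.comp

/-! ### Assembling the space -/

namespace SchauderBasis

/-- A space with a monotone basis has an equivalent norm which is strictly convex on the span of the
basis and quantitatively strictly monotone, and which agrees with the old norm on vectors whose
partial sums have sufficiently small norms. -/
theorem exists_strict_renorming {E : Type v} [NormedAddCommGroup E] [NormedSpace ℝ E]
    [CompleteSpace E] (e : SchauderBasis ℝ E) (he : ∀ n x, ‖e.proj n x‖ ≤ ‖x‖) :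
    ∃ (F : Type v) (_ : NormedAddCommGroup F) (_ : NormedSpace ℝ F) (_ : CompleteSpace F)
      (T : E ≃L[ℝ] F),
      IsMonotoneBasis (e.mapEquiv T) ∧
      (∀ n : ℕ, 1 ≤ n → ∀ x : F,
        ‖(e.mapEquiv T).proj n x‖
            + (4 : ℝ) ^ (-(n : ℤ) - 1) * ‖x - (e.mapEquiv T).proj n x‖ ≤ ‖x‖) ∧
      StrictConvexSpace ℝ (Submodule.span ℝ (Set.range (e.mapEquiv T).basis)) ∧
      (∀ x, ‖x‖ ≤ ‖T x‖) ∧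
      ∀ x, ‖x‖ ≤ 1 → (∀ k, ‖e.proj k x‖ ≤ 1 - (1 / 2 : ℝ) ^ k) → ‖T x‖ ≤ 1 := by
  obtain ⟨F, _, _, hF, T, hT⟩ := (strictSeminorm e he).exists_renorming _
    (norm_le_strictNorm e he) (strictNorm_le e he)
  replace hT : ∀ x, ‖T x‖ = strictNorm e he x := hT
  refine ⟨F, _, _, hF, T, (isMonotoneBasis_iff _).2 fun n y => ?_, fun n hn y => ?_, ?_,
    fun x => ?_, fun x hx h => ?_⟩
  · obtain ⟨x, rfl⟩ := T.surjective y
    rw [mapEquiv_proj, hT, hT]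
    exact strictNorm_proj_le e he n x
  · obtain ⟨x, rfl⟩ := T.surjective y
    rw [mapEquiv_proj, ← map_sub, hT, hT, hT]
    exact strictNorm_proj_add_le e he hn x
  · have hspan : ∀ y ∈ Submodule.span ℝ (Set.range (e.mapEquiv T).basis),
        T.symm y ∈ Submodule.span ℝ (Set.range e.basis) := fun y hy => by
      have h : Submodule.span ℝ (Set.range (e.mapEquiv T).basis) ≤
          (Submodule.span ℝ (Set.range e.basis)).comap (T.symm : F →L[ℝ] E).toLinearMap := by
        rw [Submodule.span_le]
        rintro _ ⟨i, rfl⟩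
        have : T.symm ((e.mapEquiv T).basis i) = e.basis i := T.symm_apply_apply _
        rw [SetLike.mem_coe, Submodule.mem_comap]
        exact (congrArg (· ∈ Submodule.span ℝ (Set.range e.basis)) this).mpr
          (Submodule.subset_span ⟨i, rfl⟩)
      exact h hy
    refine StrictConvexSpace.of_norm_add fun x y hx hy hxy => ?_
    have hn : ∀ z : F, strictNorm e he (T.symm z) = ‖z‖ := fun z => by rw [← hT]; simp
    have h := sameRay_of_strictNorm_add e he (hspan x.1 x.2) (hspan y.1 y.2) (by
      rw [← map_add, hn, hn, hn]
      change ‖x‖ + ‖y‖ ≤ ‖x + y‖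
      rw [hx, hy, hxy]; norm_num)
    have hinj : Function.Injective ((T.symm : F →L[ℝ] E).toLinearMap.comp
        (Submodule.span ℝ (Set.range (e.mapEquiv T).basis)).subtype) :=
      T.symm.injective.comp Subtype.val_injective
    exact hinj.sameRay_map_iff.1 h
  · rw [hT]; exact norm_le_strictNorm e he x
  · rw [hT]; exact strictNorm_le_one e he hx h

/-- The product of a space with a monotone basis and the closed span of its dual basis can be
renormed so as to contain isometric copies of `W` in both the space and the closed span of the
dual basis. -/
theorem exists_isometric_copies {W : Type} [NormedAddCommGroup W] [NormedSpace ℝ W]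
    {E : Type} [NormedAddCommGroup E] [NormedSpace ℝ E] [CompleteSpace E]
    (s : SchauderBasis ℝ E) (hs : ∀ n x, ‖s.proj n x‖ ≤ ‖x‖) (J : W →ₗᵢ[ℝ] E)
    (hJ : ∀ n x, ‖s.proj n (J x)‖ ≤ (1 - (1 / 2) ^ n) * ‖x‖)
    (hV : ∀ x r, r < ‖x‖ → ∃ φ ∈ dualBasisClosedSpan s, r ≤ φ (J x) ∧
      (∀ y, ‖φ y‖ ≤ ‖y‖) ∧ ∀ n y, ‖φ (s.proj n y)‖ ≤ (1 - (1 / 2) ^ n) * ‖y‖) :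
    ∃ (F : Type) (_ : NormedAddCommGroup F) (_ : NormedSpace ℝ F) (_ : CompleteSpace F)
      (f : SchauderBasis ℝ F),
      IsMonotoneBasis f ∧
      (∀ n : ℕ, 1 ≤ n → ∀ x : F,
        ‖f.proj n x‖ + (4 : ℝ) ^ (-(n : ℤ) - 1) * ‖x - f.proj n x‖ ≤ ‖x‖) ∧
      StrictConvexSpace ℝ (Submodule.span ℝ (Set.range f.basis)) ∧
      Nonempty (W →ₗᵢ[ℝ] F) ∧ Nonempty (W →ₗᵢ[ℝ] dualBasisClosedSpan f) := by
  let V := dualBasisClosedSpan s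
  have : CompleteSpace V := s.isClosed_dualBasisClosedSpan.completeSpace_coe
  let d : SchauderBasis ℝ V := s.dualBasis hs
  have hd : ∀ n x, ‖d.proj n x‖ ≤ ‖x‖ := s.norm_dualBasis_proj_le hs
  let e := SchauderBasis.prod s d
  have he : ∀ n x, ‖e.proj n x‖ ≤ ‖x‖ := fun n x => by
    rw [SchauderBasis.prod_proj]
    exact max_le_max (hs _ _) (hd _ _)
  obtain ⟨F, _, _, hF, T, h1, h2, h3, hle, hone⟩ := e.exists_strict_renorming he
  have hdiag : ∀ x, ‖T (J x, 0)‖ ≤ ‖x‖ := fun x => by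
    rcases eq_or_ne x 0 with rfl | hx
    · simp [← Prod.zero_eq_mk]
    have hx' := norm_pos_iff.2 hx
    have h1 : ∀ y : W, ‖y‖ = 1 → ‖T (J y, 0)‖ ≤ 1 := fun y hy => by
      refine hone _ (by simp [hy]) fun k => ?_
      rw [SchauderBasis.prod_proj]
      simp only [map_zero, Prod.norm_mk]
      refine max_le ?_ ((norm_zero (E := V)).trans_le (one_sub_half_pow_nonneg k))
      have h := hJ ((k + 1) / 2) y
      rw [hy, mul_one] at h
      -- Interleaving only delays the basis of each factor: (k + 1) / 2 ≤ k.
      exact h.trans (one_sub_half_pow_mono (by omega))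
    have h2 := h1 (‖x‖⁻¹ • x) (by rw [norm_smul, norm_inv, norm_norm, inv_mul_cancel₀ hx'.ne'])
    rw [map_smul, show ((‖x‖⁻¹ • J x, 0) : E × V) =
      ‖x‖⁻¹ • (J x, 0) by simp, map_smul, norm_smul, norm_inv, norm_norm,
      inv_mul_le_iff₀ hx', mul_one] at h2
    exact h2
  refine ⟨F, _, _, hF, e.mapEquiv T, h1, h2, h3, ⟨⟨T.toLinearEquiv.toLinearMap.comp
    ((LinearMap.inl ℝ E V).comp J.toLinearMap), fun x => le_antisymm (hdiag x) ?_⟩⟩, ?_⟩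
  · simpa using hle (J x, 0)
  -- `A` reads off the V component; `A.flip x` is evaluation of that component at x, the candidate
  -- dual copy.
  · let A : F →L[ℝ] StrongDual ℝ E :=
      (V.subtypeL.comp (ContinuousLinearMap.snd ℝ E V)).comp (T.symm : F →L[ℝ] E × V)
    have hA : ∀ z x, A.flip x (T z) = z.2.1 x := fun z x => by simp [A]
    have hmem : ∀ x, A.flip x ∈ dualBasisClosedSpan (e.mapEquiv T) := fun x =>
      s.mem_of_basis_mem A.flip _ (isClosed_dualBasisClosedSpan _) (fun i => by
        -- Evaluation at the i-th basis vector of E is the i-th coordinate functional of V, which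
        -- sits at an odd position of the product basis.
        have h : A.flip (s.basis i) = (e.mapEquiv T).coord (2 * i + 1) := by
          ext y
          obtain ⟨z, rfl⟩ := T.surjective y
          have h2 : (e.mapEquiv T).coord (2 * i + 1) (T z) = e.coord (2 * i + 1) z :=
            congrArg (e.coord (2 * i + 1)) (T.symm_apply_apply z)
          rw [hA, h2, SchauderBasis.prod_coord_odd]
          rfl
        rw [h]
        exact coord_mem_dualBasisClosedSpan _ _) x
    refine ⟨⟨(A.flip.toLinearMap.comp J.toLinearMap).codRestrict
      (dualBasisClosedSpan (e.mapEquiv T)) fun x => hmem _, fun x => ?_⟩⟩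
    change ‖A.flip (J x)‖ = ‖x‖
    refine le_antisymm (ContinuousLinearMap.opNorm_le_bound _ (norm_nonneg x) fun y => ?_)
      (le_of_forall_lt fun r hr => ?_)
    · obtain ⟨z, rfl⟩ := T.surjective y
      rw [hA, mul_comm]
      refine (z.2.1.le_opNorm _).trans ?_
      rw [LinearIsometry.norm_map]
      gcongr
      exact (le_max_right ‖z.1‖ ‖z.2‖).trans (hle z)
    · obtain ⟨r', hr', hr'x⟩ := exists_between hr
      obtain ⟨φ₀, hφ₀, hφJ, hφ1, hφn⟩ := hV x r' hr'x
      let φ : V := ⟨φ₀, hφ₀⟩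
      have hφ : ‖φ‖ ≤ 1 := ContinuousLinearMap.opNorm_le_bound _ zero_le_one fun y => by
        rw [one_mul]
        exact hφ1 y
      have hφk : ∀ k, ‖d.proj k φ‖ ≤ 1 - (1 / 2) ^ k := fun k =>
        ContinuousLinearMap.opNorm_le_bound _ (one_sub_half_pow_nonneg k) fun y => by
          change ‖(d.proj k φ).1 y‖ ≤ _
          rw [SchauderBasis.dualBasis_proj]
          exact hφn k y
      have hT1 : ‖T (0, φ)‖ ≤ 1 := by
        refine hone _ (by simpa using hφ) fun k => ?_
        rw [SchauderBasis.prod_proj]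
        simp only [map_zero, Prod.norm_mk]
        exact max_le (norm_zero.trans_le (one_sub_half_pow_nonneg k))
          ((hφk _).trans (one_sub_half_pow_mono (Nat.div_le_self k 2)))
      have h := (A.flip (J x)).le_opNorm (T (0, φ))
      rw [hA] at h
      exact hr'.trans_le (hφJ.trans ((le_abs_self _).trans
        (h.trans (mul_le_of_le_one_right (norm_nonneg _) hT1))))

/-- A universal space with a monotone basis yields a universal space whose basis satisfies the
quantitative monotonicity and strict convexity conditions, and has a universal dual span. -/
theorem exists_universal {W : Type} [NormedAddCommGroup W] [NormedSpace ℝ W]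
    [CompleteSpace W] (b : SchauderBasis ℝ W) (hb : ∀ n x, ‖b.proj n x‖ ≤ ‖x‖)
    (hW : IsometricallyUniversal.{u} W) :
    ∃ (F : Type) (_ : NormedAddCommGroup F) (_ : NormedSpace ℝ F) (_ : CompleteSpace F)
      (f : SchauderBasis ℝ F),
      IsMonotoneBasis f ∧
      (∀ n : ℕ, 1 ≤ n → ∀ x : F,
        ‖f.proj n x‖ + (4 : ℝ) ^ (-(n : ℤ) - 1) * ‖x - f.proj n x‖ ≤ ‖x‖) ∧
      StrictConvexSpace ℝ (Submodule.span ℝ (Set.range f.basis)) ∧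
      IsometricallyUniversal.{u} F ∧
      IsometricallyUniversal.{u} (dualBasisClosedSpan f) := by
  obtain ⟨F, _, _, hF, f, h1, h2, h3, ⟨S⟩, ⟨R⟩⟩ := (b.sum hb).exists_isometric_copies
    (norm_sum_proj_le b hb) (diagonal W) (norm_proj_diagonal_le b hb) fun x r hr => by
      obtain ⟨ψ, hψ, hψx⟩ := exists_dual_vector'' ℝ x
      have hlim : Tendsto (fun n => ψ (b.proj n x)) atTop (𝓝 ‖x‖) := by
        have := (ψ.continuous.tendsto x).comp (b.tendsto_proj x)
        rw [hψx] at this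
        exact this
      obtain ⟨n, hn⟩ := (hlim.eventually_const_lt hr).exists
      have hcomp : ∀ y, ‖ψ (b.proj n y)‖ ≤ ‖y‖ := fun y =>
        (ψ.le_of_opNorm_le hψ _).trans (by rw [one_mul]; exact hb n y)
      -- Truncating the norming functional by a projection puts it in the closed span of the dual
      -- basis, losing arbitrarily little at x.
      refine ⟨(ψ.comp (b.proj n)).comp (codiagonal W), comp_proj_comp_codiagonal_mem b hb ψ n, ?_,
        fun y => (hcomp _).trans (norm_codiagonal_le y b hb),
        fun k y => (hcomp _).trans (norm_codiagonal_proj_le b hb k y)⟩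
      change r ≤ ψ (b.proj n (codiagonal W (diagonal W x)))
      rw [codiagonal_diagonal]
      exact hn.le
  exact ⟨F, _, _, hF, f, h1, h2, h3, hW.of_isometry S, hW.of_isometry R⟩

end SchauderBasis

/-! ### The cylinder basis on the Cantor space -/

namespace Cantor

/-- The integer whose binary digits are the first `k` terms of a point of the Cantor space. -/
def trunc (x : ℕ → Bool) : ℕ → ℕ
  | 0 => 0
  | k + 1 => trunc x k + (x k).toNat * 2 ^ k

theorem trunc_succ (x : ℕ → Bool) (k : ℕ) : trunc x (k + 1) = trunc x k + (x k).toNat * 2 ^ k :=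
  rfl

theorem trunc_lt (x : ℕ → Bool) (k : ℕ) : trunc x k < 2 ^ k := by
  induction k with
  | zero => simp [trunc]
  | succ k ih =>
    rw [trunc_succ, pow_succ]
    have := Bool.toNat_le (x k)
    nlinarith

theorem trunc_mono (x : ℕ → Bool) : Monotone (trunc x) :=
  monotone_nat_of_le_succ fun _ => Nat.le_add_right _ _

theorem trunc_mod (x : ℕ → Bool) {j k : ℕ} (h : j ≤ k) : trunc x k % 2 ^ j = trunc x j := by
  induction k, h using Nat.le_induction with
  | base => exact Nat.mod_eq_of_lt (trunc_lt x j)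
  | succ k hk ih =>
    obtain ⟨d, rfl⟩ := Nat.exists_eq_add_of_le hk
    rw [trunc_succ, pow_add, mul_left_comm, Nat.add_mul_mod_self_left, ih]

theorem testBit_trunc (x : ℕ → Bool) {j k : ℕ} (h : j < k) : (trunc x k).testBit j = x j := by
  have h1 := trunc_mod x (Nat.succ_le_of_lt h)
  rw [Nat.succ_eq_add_one, Nat.mod_pow_succ, trunc_mod x h.le, trunc_succ, ← Nat.toNat_testBit,
    mul_comm, Nat.add_left_cancel_iff] at h1
  have h2 := Nat.eq_of_mul_eq_mul_right (by positivity) h1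
  revert h2
  cases (trunc x k).testBit j <;> cases x j <;> simp

theorem trunc_testBit (i k : ℕ) : trunc i.testBit k = i % 2 ^ k := by
  induction k with
  | zero => simp [trunc, Nat.mod_one]
  | succ k ih => rw [trunc_succ, ih, Nat.mod_pow_succ, Nat.toNat_testBit, mul_comm]

theorem mod_two_pow_size (i : ℕ) : i % 2 ^ i.size = i := Nat.mod_eq_of_lt (Nat.lt_size_self i)

theorem trunc_size_eq {x : ℕ → Bool} {i k : ℕ} (h : trunc x k = i) : trunc x i.size = i := by
  have h1 : i.size ≤ k := Nat.size_le.2 (h ▸ trunc_lt x k)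
  rw [← trunc_mod x h1, h, mod_two_pow_size]

theorem continuous_trunc (k : ℕ) : Continuous fun x => trunc x k := by
  induction k with
  | zero => exact continuous_const
  | succ k ih =>
    have h : Continuous fun x : ℕ → Bool => (x k).toNat :=
      (continuous_of_discreteTopology (f := Bool.toNat)).comp (continuous_apply k)
    exact ih.add (h.mul continuous_const)

/-- The integer obtained from `i` by removing its leading binary digit. -/
def parent (i : ℕ) : ℕ := i % 2 ^ (i.size - 1)

/-- The indicator function of the cylinder determined by the binary digits of `i`. -/
def cylinder (i : ℕ) : C(ℕ → Bool, ℝ) where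
  toFun x := if trunc x i.size = i then 1 else 0
  continuous_toFun :=
    (continuous_of_discreteTopology (f := fun m : ℕ => if m = i then (1 : ℝ) else 0)).comp
      (continuous_trunc i.size)

theorem cylinder_apply (i : ℕ) (x : ℕ → Bool) :
    cylinder i x = if trunc x i.size = i then 1 else 0 := rfl

/-- The coordinate functionals of the basis of cylinder functions. -/
noncomputable def coord (i : ℕ) : StrongDual ℝ C(ℕ → Bool, ℝ) :=
  ContinuousMap.evalCLM ℝ i.testBit -
    if i = 0 then 0 else ContinuousMap.evalCLM ℝ (parent i).testBit

theorem coord_zero_apply (f : C(ℕ → Bool, ℝ)) : coord 0 f = f (Nat.testBit 0) := by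
  simp [coord]

theorem coord_apply {i : ℕ} (hi : i ≠ 0) (f : C(ℕ → Bool, ℝ)) :
    coord i f = f i.testBit - f (parent i).testBit := by
  simp [coord, hi]

theorem two_pow_size_sub_one_le {i : ℕ} (hi : i ≠ 0) : 2 ^ (i.size - 1) ≤ i := by
  have h : 0 < i.size := Nat.size_pos.2 (Nat.pos_of_ne_zero hi)
  exact Nat.lt_size.1 (by omega)

theorem parent_lt {i : ℕ} (hi : i ≠ 0) : parent i < i :=
  (Nat.mod_lt _ (by positivity)).trans_le (two_pow_size_sub_one_le hi)

theorem coord_cylinder (i j : ℕ) : coord i (cylinder j) = if i = j then 1 else 0 := by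
  rcases eq_or_ne i 0 with rfl | hi
  · rw [coord_zero_apply, cylinder_apply, trunc_testBit, Nat.zero_mod]
  rw [coord_apply hi, cylinder_apply, cylinder_apply, trunc_testBit, trunc_testBit]
  -- A cylinder using fewer digits than i cannot separate i from its parent. Otherwise it sees all
  -- digits of both and tests equality with j.
  rcases lt_or_ge j.size i.size with h | h
  · have h1 : parent i % 2 ^ j.size = i % 2 ^ j.size :=
      Nat.mod_mod_of_dvd _ (pow_dvd_pow 2 (by omega))
    have h2 : i ≠ j := by rintro rfl; exact lt_irrefl _ h
    rw [h1, sub_self, if_neg h2]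
  · have h1 : i < 2 ^ j.size := (Nat.lt_size_self i).trans_le (Nat.pow_le_pow_right (by norm_num) h)
    have h2 : parent i ≠ j := by
      rintro rfl
      have h3 : (parent i).size ≤ i.size - 1 := Nat.size_le.2 (Nat.mod_lt _ (by positivity))
      have h4 : 0 < i.size := Nat.size_pos.2 (Nat.pos_of_ne_zero hi)
      omega
    rw [Nat.mod_eq_of_lt h1, Nat.mod_eq_of_lt ((parent_lt hi).trans h1), if_neg h2, sub_zero]

/-- Partial sums interpolate: the differences telescope along parents, leaving f at the largest
truncation of x not exceeding n. Hence their contractivity. -/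
theorem exists_sum_cylinder (n : ℕ) (x : ℕ → Bool) : ∃ k, trunc x k ≤ n ∧
    (∀ k', trunc x k' ≤ n → trunc x k' ≤ trunc x k) ∧
    ∀ f : C(ℕ → Bool, ℝ), (∑ i ∈ Finset.range (n + 1), coord i f • cylinder i) x =
      f (trunc x k).testBit := by
  induction n with
  | zero =>
    refine ⟨0, le_rfl, fun _ h => h, fun f => ?_⟩
    simp [coord_zero_apply, cylinder_apply, trunc]
  | succ n ih =>
    obtain ⟨k, hk, hmax, hf⟩ := ih
    by_cases hx : trunc x (n + 1).size = n + 1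
    · refine ⟨(n + 1).size, hx.le, fun k' h => hx.symm ▸ h, fun f => ?_⟩
      have hs : 0 < (n + 1).size := Nat.size_pos.2 (Nat.succ_pos n)
      have hp : parent (n + 1) = trunc x ((n + 1).size - 1) := by
        rw [parent, ← trunc_mod x (Nat.sub_le (n + 1).size 1), hx]
      have h1 : k ≤ (n + 1).size - 1 := by
        by_contra h
        have := trunc_mono x (show (n + 1).size ≤ k by omega)
        omega
      have h2 : parent (n + 1) = trunc x k :=
        le_antisymm (hp ▸ hmax _ (hp ▸ Nat.lt_succ_iff.1 (parent_lt (Nat.succ_ne_zero n))))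
          (hp ▸ trunc_mono x h1)
      rw [Finset.sum_range_succ, ContinuousMap.add_apply, hf, ContinuousMap.smul_apply,
        cylinder_apply, if_pos hx, hx, coord_apply (Nat.succ_ne_zero n), h2]
      simp
    · refine ⟨k, hk.trans (Nat.le_succ n), fun k' h => hmax k' ?_, fun f => ?_⟩
      · rcases Nat.le_succ_iff.1 h with h | h
        · exact h
        · exact absurd (trunc_size_eq h) hx
      · rw [Finset.sum_range_succ, ContinuousMap.add_apply, hf, ContinuousMap.smul_apply,
          cylinder_apply, if_neg hx, smul_zero, add_zero]

theorem norm_sum_cylinder_le (n : ℕ) (f : C(ℕ → Bool, ℝ)) :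
    ‖∑ i ∈ Finset.range n, coord i f • cylinder i‖ ≤ ‖f‖ := by
  refine (ContinuousMap.norm_le _ (norm_nonneg f)).2 fun x => ?_
  rcases n with - | n
  · simp
  · obtain ⟨k, -, -, hf⟩ := exists_sum_cylinder n x
    rw [hf]
    exact f.norm_coe_le_norm _

theorem sum_two_pow_cylinder_apply (m : ℕ) (f : C(ℕ → Bool, ℝ)) (x : ℕ → Bool) :
    (∑ i ∈ Finset.range (2 ^ m), coord i f • cylinder i) x = f (trunc x m).testBit := by
  obtain ⟨n, hn⟩ : ∃ n, 2 ^ m = n + 1 := ⟨2 ^ m - 1, by have := Nat.two_pow_pos m; omega⟩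
  obtain ⟨k, hk, hmax, hf⟩ := exists_sum_cylinder n x
  have h1 := hmax m (by have := trunc_lt x m; omega)
  have h2 : trunc x k = trunc x m := by
    rcases le_total k m with h | h
    · exact le_antisymm (trunc_mono x h) h1
    · rw [← trunc_mod x h, Nat.mod_eq_of_lt (by omega)]
  rw [hn, hf, h2]

/-- In the product uniformity only finitely many digits matter, and digit j is already exact once m
> j, for all x at once. -/
theorem tendstoUniformly_testBit_trunc :
    TendstoUniformly (fun m (x : ℕ → Bool) => (trunc x m).testBit) id atTop := by
  simp only [tendstoUniformly_iff_tendsto, Pi.uniformity, tendsto_iInf, tendsto_comap_iff]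
  intro j s hs
  rw [mem_map]
  filter_upwards [(eventually_gt_atTop j).prod_inl ⊤] with q hq
  simp only [Set.mem_preimage, Function.comp_apply, testBit_trunc q.2 hq]
  exact refl_mem_uniformity hs

theorem tendsto_sum_two_pow_cylinder (f : C(ℕ → Bool, ℝ)) :
    Tendsto (fun m => ∑ i ∈ Finset.range (2 ^ m), coord i f • cylinder i) atTop (𝓝 f) := by
  rw [ContinuousMap.tendsto_iff_tendstoUniformly]
  have h := (CompactSpace.uniformContinuous_of_continuous f.continuous).comp_tendstoUniformly
    tendstoUniformly_testBit_trunc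
  simpa [Function.comp_def, sum_two_pow_cylinder_apply] using h

/-- The monotone basis of cylinder functions of the space of continuous functions on the Cantor
space. -/
noncomputable def basis : SchauderBasis ℝ C(ℕ → Bool, ℝ) :=
  SchauderBasis.ofDense cylinder coord coord_cylinder norm_sum_cylinder_le fun f =>
    mem_closure_of_tendsto (tendsto_sum_two_pow_cylinder f) (Eventually.of_forall fun _ =>
      Submodule.sum_mem _ fun i _ => Submodule.smul_mem _ _ (Submodule.subset_span ⟨i, rfl⟩))

theorem norm_basis_proj_le (n : ℕ) (f : C(ℕ → Bool, ℝ)) : ‖basis.proj n f‖ ≤ ‖f‖ := by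
  rw [SchauderBasis.proj_apply]
  exact norm_sum_cylinder_le n f

end Cantor

theorem mainTheorem6 :
    ∃ (F : Type) (_ : NormedAddCommGroup F) (_ : NormedSpace ℝ F) (_ : CompleteSpace F)
      (f : SchauderBasis ℝ F),
      IsMonotoneBasis f ∧
      (∀ n : ℕ, 1 ≤ n → ∀ x : F,
        ‖SchauderBasis.proj f n x‖
            + (4 : ℝ) ^ (-(n : ℤ) - 1) * ‖x - SchauderBasis.proj f n x‖ ≤ ‖x‖) ∧
      StrictConvexSpace ℝ (Submodule.span ℝ (Set.range f.basis)) ∧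
      IsometricallyUniversal.{u} F ∧
      IsometricallyUniversal.{u} (dualBasisClosedSpan f) :=
  Cantor.basis.exists_universal Cantor.norm_basis_proj_le isometricallyUniversal_cantor
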